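/- Let $T>0$ and let $g(t)$, $t\in[0,T]$, be a smooth one-parameter family (smooth jointly in $(x,t)\in\mathbb{R}^2\times[0,T]$) of Riemannian metrics on $\mathbb{R}^2$ that are conformal to the Euclidean metric $g_E=dx_1^2+dx_2^2$, that is, $g(t)=e^{2w(x,t)}g_E$ for some function $w:\mathbb{R}^2\times[0,T]\to\mathbb{R}$. Let $\Delta_{g(t)}$ be the Laplace–Beltrami operator of $g(t)$, $\Delta_g f=\frac{1}{\sqrt{\det g}}\sum_{i,j}\partial_i\big(\sqrt{\det g}\,g^{ij}\partial_j f\big)$. Let $h:\mathbb{R}^2\times[0,T]\to\mathbb{R}$ be a smooth function, and let $u:\mathbb{R}^2\times[0,T]\to\mathbb{R}$ be a continuous function that is, for $t\in(0,T]$, of class $C^2$ in $x$ and differentiable in $t$ (from the left at $t=T$), and that satisfies $$\frac{\partial}{\partial t}u\le\Delta_{g(t)}u+hu\qquad\text{on }\mathbb{R}^2\times(0,T].$$ If $u(x,0)\le 0$ for all $x\in\mathbb{R}^2$ and both $u$ and $h$ are uniformly bounded on $\mathbb{R}^2\times[0,T]$, then $u(x,t)\le 0$ for all $(x,t)\in\mathbb{R}^2\times[0,T]$.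 -/

import Mathlib

open Set
open scoped Manifold ContDiff InnerProductSpace

/-- The Euclidean plane. -/
abbrev Plane : Type := EuclideanSpace ℝ (Fin 2)

/-- A smooth Riemannian metric on the plane. -/
abbrev PlaneMetric : Type :=
  Bundle.ContMDiffRiemannianMetric 𝓘(ℝ, Plane) ∞ Plane
    (fun x : Plane => TangentSpace 𝓘(ℝ, Plane) x)

namespace PlaneMetric

/-- The metric tensor at `x`, as a bilinear form on the plane (which is its own tangent space). -/
def form (g : PlaneMetric) (x : Plane) : Plane →L[ℝ] Plane →L[ℝ] ℝ := g.inner x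

/-- The matrix `(g_ij)` of the metric in the standard coordinates. -/
noncomputable def gram (g : PlaneMetric) (x : Plane) : Matrix (Fin 2) (Fin 2) ℝ :=
  Matrix.of fun i j => g.form x (EuclideanSpace.single i 1) (EuclideanSpace.single j 1)

end PlaneMetric

/-- The partial derivative `∂_i f` in the standard coordinates. -/
noncomputable def partialDeriv (i : Fin 2) (f : Plane → ℝ) (x : Plane) : ℝ :=
  fderiv ℝ f x (EuclideanSpace.single i 1)

/-- The Laplace-Beltrami operator
`Δ_g f = (det g)^(-1/2) ∑ i, ∂_i (∑ j, (det g)^(1/2) g^{ij} ∂_j f)`. -/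
noncomputable def laplaceBeltrami (g : PlaneMetric) (f : Plane → ℝ) (x : Plane) : ℝ :=
  (√(g.gram x).det)⁻¹ *
    ∑ i, partialDeriv i
      (fun y => ∑ j, √(g.gram y).det * (g.gram y)⁻¹ i j * partialDeriv j f y) x

/-- The family `g(t)`, `t ∈ [0,T]`, is smooth jointly in space and time. -/
def IsSmoothFamily (g : ℝ → PlaneMetric) (T : ℝ) : Prop :=
  ContDiffOn ℝ ∞ (fun p : Plane × ℝ => (g p.2).form p.1) (univ ×ˢ Icc 0 T)

/-- Each `g(t)`, `t ∈ [0,T]`, has the form `e^{2w(x,t)} g_E`, with `g_E` the Euclidean metric. -/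
def IsConformallyFlatFamily (g : ℝ → PlaneMetric) (T : ℝ) : Prop :=
  ∃ w : Plane → ℝ → ℝ, ∀ t ∈ Icc 0 T, ∀ x v v' : Plane,
    (g t).form x v v' = Real.exp (2 * w x t) * ⟪v, v'⟫_ℝ

/-- `f` is uniformly bounded on `ℝ² × [0,T]`. -/
def IsUniformlyBounded (f : Plane → ℝ → ℝ) (T : ℝ) : Prop :=
  ∃ C : ℝ, ∀ x, ∀ t ∈ Icc 0 T, |f x t| ≤ C

/-- Classical regularity of `u` on `ℝ² × [0,T]`: jointly continuous and, for positive times,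
twice continuously differentiable in space and differentiable in time (from the left at `T`). -/
structure IsClassical (u : Plane → ℝ → ℝ) (T : ℝ) : Prop where
  continuousOn : ContinuousOn (fun p : Plane × ℝ => u p.1 p.2) (univ ×ˢ Icc 0 T)
  contDiff_space : ∀ t ∈ Ioc 0 T, ContDiff ℝ 2 (fun x => u x t)
  differentiable_time : ∀ x, ∀ t ∈ Ioc 0 T,
    DifferentiableWithinAt ℝ (fun s => u x s) (Icc 0 T) t

/-! In dimension two the Laplacian of `e^{2w} g_E` is `e^{-2w}` times the flat one
(`laplaceBeltrami_of_conformal`), so a barrier that is flat-superharmonic near infinity is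
superharmonic there for every `g(t)`, however `w` behaves at infinity. With `φ = logBarrier`, which
grows like `log ‖x‖²`, the function `e^{-Kt} u - ε (φ + L t)` attains a positive maximum if `u` is
positive somewhere and `ε` is small. There the derivative tests in space and time contradict the
differential inequality. Only the unit disc, where `φ` is not superharmonic, requires a bound on
`e^{-2w}`, and compactness supplies it (`exists_inv_conformalFactor_le`). -/

namespace PlaneMetric

lemma gram_of_conformal {g : PlaneMetric} {w : Plane → ℝ}
    (hg : ∀ x v v' : Plane, g.form x v v' = Real.exp (2 * w x) * ⟪v, v'⟫_ℝ) (x : Plane) :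
    g.gram x = Real.exp (2 * w x) • (1 : Matrix (Fin 2) (Fin 2) ℝ) := by
  ext i j
  simp only [gram, Matrix.of_apply, hg, Matrix.smul_apply, smul_eq_mul]
  fin_cases i <;> fin_cases j <;> simp [EuclideanSpace.inner_single_left]

end PlaneMetric

/-- The Laplace-Beltrami operator of a conformally flat metric on the plane is a multiple of the
flat Laplacian. -/
lemma laplaceBeltrami_of_conformal {g : PlaneMetric} {w : Plane → ℝ}
    (hg : ∀ x v v' : Plane, g.form x v v' = Real.exp (2 * w x) * ⟪v, v'⟫_ℝ)
    (f : Plane → ℝ) (x : Plane) :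
    laplaceBeltrami g f x =
      (Real.exp (2 * w x))⁻¹ * ∑ i, partialDeriv i (partialDeriv i f) x := by
  have hdet : ∀ y, √(g.gram y).det = Real.exp (2 * w y) := fun y => by
    rw [PlaneMetric.gram_of_conformal hg, Matrix.det_smul, Matrix.det_one, mul_one,
      Fintype.card_fin, Real.sqrt_sq (Real.exp_pos _).le]
  have hinv : ∀ y, (g.gram y)⁻¹ = (Real.exp (2 * w y))⁻¹ • (1 : Matrix (Fin 2) (Fin 2) ℝ) :=
    fun y => Matrix.inv_eq_left_inv <| by
      rw [PlaneMetric.gram_of_conformal hg, smul_mul_smul_comm, one_mul,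
        inv_mul_cancel₀ (Real.exp_pos _).ne', one_smul]
  have hcoef : ∀ i, (fun y => ∑ j, √(g.gram y).det * (g.gram y)⁻¹ i j * partialDeriv j f y) =
      partialDeriv i f := fun i => by
    funext y
    have h0 := (Real.exp_pos (2 * w y)).ne'
    rw [hdet, hinv]
    fin_cases i <;> simp [h0]
  simp only [laplaceBeltrami, hcoef]
  rw [hdet]

/-- Second derivative test: at an interior maximum the second derivative is nonpositive. -/
lemma IsLocalMax.deriv_deriv_nonpos {k : ℝ → ℝ} {a : ℝ} (hmax : IsLocalMax k a)
    (hk : ContinuousAt k a) : deriv (deriv k) a ≤ 0 := by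
  by_contra! hpos
  -- A point that is both a local maximum and a local minimum makes `k` locally constant, so its
  -- second derivative vanishes.
  have hmin := isLocalMin_of_deriv_deriv_pos hpos hmax.deriv_eq_zero hk
  have hconst : k =ᶠ[nhds a] fun _ => k a := by
    filter_upwards [hmax, hmin] with s h₁ h₂ using le_antisymm h₁ h₂
  have := hconst.deriv.deriv_eq
  simp at this
  linarith

/-- If `p` touches `f` from above at `x` along the line in direction `e_i`, then its second
derivative dominates `∂_i ∂_i f`. -/
lemma partialDeriv_partialDeriv_le {f : Plane → ℝ} (hf : ContDiff ℝ 2 f) {x : Plane} {i : Fin 2}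
    {p p' : ℝ → ℝ} {p'' : ℝ} (hp : ∀ᶠ s in nhds 0, HasDerivAt p (p' s) s)
    (hp' : HasDerivAt p' p'' 0)
    (hmax : IsLocalMax (fun s : ℝ => f (x + s • EuclideanSpace.single i 1) - p s) 0) :
    partialDeriv i (partialDeriv i f) x ≤ p'' := by
  set e : Plane := EuclideanSpace.single i 1 with he
  have hline : ∀ s : ℝ, HasDerivAt (fun s : ℝ => x + s • e) e s := fun s => by
    simpa using ((hasDerivAt_id s).smul_const e).const_add x
  have h₁ : ∀ s : ℝ, HasDerivAt (fun s : ℝ => f (x + s • e))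
      (partialDeriv i f (x + s • e)) s := fun s =>
    ((hf.differentiable (by norm_num)) _).hasFDerivAt.comp_hasDerivAt s (hline s)
  have hd : Differentiable ℝ (partialDeriv i f) :=
    ((hf.fderiv_right (m := 1) (by norm_num)).differentiable (by norm_num)).clm_apply
      (differentiable_const _)
  have h₂ : HasDerivAt (fun s : ℝ => partialDeriv i f (x + s • e))
      (partialDeriv i (partialDeriv i f) x) 0 := by
    have := (hd (x + (0 : ℝ) • e)).hasFDerivAt.comp_hasDerivAt 0 (hline 0)
    simpa [partialDeriv, Function.comp_def] using this
  have hderiv : deriv (fun s : ℝ => f (x + s • e) - p s) =ᶠ[nhds 0]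
      fun s => partialDeriv i f (x + s • e) - p' s := by
    filter_upwards [hp] with s hs using ((h₁ s).sub hs).deriv
  have h := hmax.deriv_deriv_nonpos ((h₁ 0).sub hp.self_of_nhds).continuousAt
  have h' := (h₂.sub hp').deriv
  rw [hderiv.deriv_eq] at h
  exact sub_nonpos.1 (h'.ge.trans h)

/-- At the right end point of an interval where the maximum is attained, the left derivative is
nonnegative. -/
lemma HasDerivWithinAt.nonneg_of_max_right {f : ℝ → ℝ} {f' a b c : ℝ}
    (hf : HasDerivWithinAt f f' (Icc a c) b) (hab : a < b) (hbc : b ≤ c)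
    (hmax : ∀ s ∈ Icc a b, f s ≤ f b) : 0 ≤ f' := by
  have hf' := (hf.mono (Icc_subset_Icc_right hbc)).hasFDerivWithinAt
  have hloc : IsLocalMaxOn f (Icc a b) b := IsMaxOn.localize hmax
  have := hloc.hasFDerivWithinAt_nonpos hf' (y := a - b)
    (sub_mem_posTangentConeAt_of_segment_subset (by
      rw [segment_symm, segment_eq_Icc hab.le]))
  simp at this
  nlinarith

/-- A proper function on the plane, superharmonic outside the unit disc. -/
noncomputable def logBarrier (x : Plane) : ℝ :=
  if ‖x‖ ^ 2 ≤ 1 then ‖x‖ ^ 2 else 1 + Real.log (‖x‖ ^ 2)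

/-- Since `φ ≤ ‖x‖²` everywhere, with equality on the closed disc, the smooth `‖x‖²` can replace `φ`
as touching function there; the kink on the unit circle does no harm. -/
lemma logBarrier_le_sq (x : Plane) : logBarrier x ≤ ‖x‖ ^ 2 := by
  unfold logBarrier
  split_ifs with h
  · exact le_rfl
  · linarith [Real.log_le_sub_one_of_pos (by linarith : 0 < ‖x‖ ^ 2)]

lemma logBarrier_nonneg (x : Plane) : 0 ≤ logBarrier x := by
  unfold logBarrier
  split_ifs with h
  · positivity
  · linarith [Real.log_nonneg (not_le.1 h).le]

lemma continuous_logBarrier : Continuous logBarrier := by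
  have h : logBarrier = fun x => min (‖x‖ ^ 2) 1 + Real.log (max (‖x‖ ^ 2) 1) := by
    funext x
    unfold logBarrier
    split_ifs with h
    · simp [h]
    · simp [(not_le.1 h).le]
  rw [h]
  have : Continuous fun x : Plane => max (‖x‖ ^ 2) 1 := by fun_prop
  exact (by fun_prop : Continuous fun x : Plane => min (‖x‖ ^ 2) 1).add
    (this.log fun x => (lt_of_lt_of_le one_pos (le_max_right _ _)).ne')

lemma le_logBarrier_of_exp_le {x : Plane} {m : ℝ} (hm : 0 ≤ m) (hx : Real.exp m < ‖x‖) :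
    m ≤ logBarrier x := by
  have h1 : 1 ≤ Real.exp m := Real.one_le_exp hm
  have h2 : Real.exp m ≤ ‖x‖ ^ 2 := by nlinarith
  rw [logBarrier, if_neg (by nlinarith)]
  linarith [(Real.le_log_iff_exp_le (by nlinarith)).2 h2]

lemma norm_add_smul_single_sq (x : Plane) (i : Fin 2) (s : ℝ) :
    ‖x + s • EuclideanSpace.single i (1 : ℝ)‖ ^ 2 = ‖x‖ ^ 2 + 2 * x i * s + s ^ 2 := by
  fin_cases i <;> simp [EuclideanSpace.norm_sq_eq, Fin.sum_univ_two] <;> ring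

/-- The flat Laplacian of a function touched from above by a multiple of the barrier. -/
lemma sum_partialDeriv_le_of_isLocalMax_sub_logBarrier {f : Plane → ℝ} (hf : ContDiff ℝ 2 f)
    {x : Plane} {c : ℝ} (hc : 0 ≤ c) (hmax : ∀ y, f y - c * logBarrier y ≤ f x - c * logBarrier x) :
    ∑ i, partialDeriv i (partialDeriv i f) x ≤ if ‖x‖ ^ 2 ≤ 1 then 4 * c else 0 := by
  have hN : ∀ (i : Fin 2) (s : ℝ), HasDerivAt (fun s : ℝ => ‖x‖ ^ 2 + 2 * x i * s + s ^ 2)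
      (2 * x i + 2 * s) s := fun i s => by
    have := (((hasDerivAt_id s).const_mul (2 * x i)).const_add (‖x‖ ^ 2)).add (hasDerivAt_pow 2 s)
    simpa [Pi.add_def] using this
  have hN' : ∀ i : Fin 2, HasDerivAt (fun s : ℝ => 2 * x i + 2 * s) 2 0 := fun i => by
    simpa using ((hasDerivAt_id (0 : ℝ)).const_mul 2).const_add (2 * x i)
  split_ifs with hx
  · have key : ∀ i, partialDeriv i (partialDeriv i f) x ≤ c * 2 := fun i =>
      partialDeriv_partialDeriv_le hf (Filter.Eventually.of_forall fun s => (hN i s).const_mul c)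
        ((hN' i).const_mul c) <| Filter.Eventually.of_forall fun s => by
          have h₁ := hmax (x + s • EuclideanSpace.single i 1)
          have h₂ := mul_le_mul_of_nonneg_left
            (logBarrier_le_sq (x + s • EuclideanSpace.single i 1)) hc
          have h₃ : logBarrier x = ‖x‖ ^ 2 := if_pos hx
          rw [norm_add_smul_single_sq] at h₂
          rw [h₃] at h₁
          simp only [zero_smul, add_zero, mul_zero, ne_eq, OfNat.ofNat_ne_zero, not_false_eq_true,
            zero_pow]
          linarith
    rw [Fin.sum_univ_two]
    linarith [key 0, key 1]
  · push Not at hx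
    have hgt : ∀ i : Fin 2, ∀ᶠ s : ℝ in nhds 0, 1 < ‖x‖ ^ 2 + 2 * x i * s + s ^ 2 := fun i =>
      (hN i 0).continuousAt.eventually_const_lt (by simpa using hx)
    have key : ∀ i, partialDeriv i (partialDeriv i f) x ≤
        c * ((2 * ‖x‖ ^ 2 - 2 * x i * (2 * x i)) / (‖x‖ ^ 2) ^ 2) := fun i => by
      refine partialDeriv_partialDeriv_le hf
        (p := fun s => c * (1 + Real.log (‖x‖ ^ 2 + 2 * x i * s + s ^ 2)))
        (p' := fun s => c * ((2 * x i + 2 * s) / (‖x‖ ^ 2 + 2 * x i * s + s ^ 2))) ?_ ?_ ?_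
      · filter_upwards [hgt i] with s hs
        exact (((hN i s).log (by linarith)).const_add 1).const_mul c
      · have := ((hN' i).div (hN i 0) (by simp; intro h; simp [h] at hx; linarith)).const_mul c
        simpa using this
      · filter_upwards [hgt i] with s hs
        have h₁ := hmax (x + s • EuclideanSpace.single i 1)
        rw [logBarrier, norm_add_smul_single_sq, if_neg (not_le.2 hs), logBarrier,
          if_neg (not_le.2 hx)] at h₁
        simpa using h₁
    rw [Fin.sum_univ_two]
    have h0 := key 0
    have h1 := key 1
    have hsum : ‖x‖ ^ 2 = x 0 ^ 2 + x 1 ^ 2 := by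
      simp [EuclideanSpace.norm_sq_eq, Fin.sum_univ_two]
    -- Harmonicity of `log ‖x‖²` in the plane.
    have : c * ((2 * ‖x‖ ^ 2 - 2 * x 0 * (2 * x 0)) / (‖x‖ ^ 2) ^ 2) +
        c * ((2 * ‖x‖ ^ 2 - 2 * x 1 * (2 * x 1)) / (‖x‖ ^ 2) ^ 2) = 0 := by
      rw [← mul_add, ← add_div, hsum]
      ring
    linarith

/-- The conformal factor of a smooth family is bounded below over the closed unit disc. -/
lemma IsSmoothFamily.exists_inv_conformalFactor_le {g : ℝ → PlaneMetric} {T : ℝ}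
    (hg : IsSmoothFamily g T) {w : Plane → ℝ → ℝ}
    (hw : ∀ t ∈ Icc 0 T, ∀ x v v' : Plane,
      (g t).form x v v' = Real.exp (2 * w x t) * ⟪v, v'⟫_ℝ) :
    ∃ C : ℝ, 0 ≤ C ∧ ∀ x : Plane, ‖x‖ ≤ 1 → ∀ t ∈ Icc 0 T, (Real.exp (2 * w x t))⁻¹ ≤ C := by
  let e : Plane := EuclideanSpace.single 0 1
  have he : ∀ x, ∀ t ∈ Icc 0 T, (g t).form x e e = Real.exp (2 * w x t) := fun x t ht => by
    rw [hw t ht]; simp [e]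
  have hcont : ContinuousOn (fun p : Plane × ℝ => ((g p.2).form p.1 e e)⁻¹)
      (Metric.closedBall 0 1 ×ˢ Icc 0 T) := by
    refine ContinuousOn.inv₀ ?_ fun p hp => by rw [he _ _ hp.2]; exact (Real.exp_pos _).ne'
    exact (((ContDiffOn.continuousOn hg).mono (prod_mono_left (subset_univ _))).clm_apply
      continuousOn_const).clm_apply continuousOn_const
  obtain ⟨C, hC⟩ := ((isCompact_closedBall (0 : Plane) 1).prod isCompact_Icc).bddAbove_image hcont
  refine ⟨max C 0, le_max_right _ _, fun x hx t ht => (le_max_left C 0).trans' ?_⟩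
  rw [← he x t ht]
  exact hC ⟨(x, t), ⟨by simpa using hx, ht⟩, rfl⟩

theorem mainTheorem2 (T : ℝ) (hT : 0 < T) (g : ℝ → PlaneMetric)
    (hg : IsSmoothFamily g T) (hflat : IsConformallyFlatFamily g T)
    (u h : Plane → ℝ → ℝ) (hu : IsClassical u T)
    (hh : ContDiffOn ℝ ∞ (fun p : Plane × ℝ => h p.1 p.2) (univ ×ˢ Icc 0 T))
    (hineq : ∀ x, ∀ t ∈ Ioc 0 T,
      derivWithin (fun s => u x s) (Icc 0 T) t ≤
        laplaceBeltrami (g t) (fun y => u y t) x + h x t * u x t)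
    (hinit : ∀ x, u x 0 ≤ 0)
    (hubdd : IsUniformlyBounded u T) (hhbdd : IsUniformlyBounded h T) :
    ∀ x, ∀ t ∈ Icc 0 T, u x t ≤ 0 := by
  obtain ⟨w, hw⟩ := hflat
  obtain ⟨C, hC0, hC⟩ := hg.exists_inv_conformalFactor_le hw
  obtain ⟨M, hM⟩ := hubdd
  obtain ⟨K, hK⟩ := hhbdd
  have h0T : (0 : ℝ) ∈ Icc 0 T := ⟨le_rfl, hT.le⟩
  have hM0 : 0 ≤ M := (abs_nonneg _).trans (hM 0 0 h0T)
  have hK0 : 0 ≤ K := (abs_nonneg _).trans (hK 0 0 h0T)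
  intro x₁ t₁ ht₁
  by_contra! hpos
  -- The flat Laplacian of `‖x‖²` is 4, so `4 * C` absorbs the disc contribution; the extra 1 makes
  -- the final inequality strict.
  set L : ℝ := 4 * C + 1 with hL
  have hL0 : 0 < L := by positivity
  have hB₁ : 0 ≤ logBarrier x₁ + L * t₁ :=
    add_nonneg (logBarrier_nonneg _) (mul_nonneg hL0.le ht₁.1)
  obtain ⟨ε, hε, hε₁⟩ : ∃ ε > 0, ε * (logBarrier x₁ + L * t₁) < Real.exp (-K * t₁) * u x₁ t₁ :=
    exists_pos_mul_lt (mul_pos (Real.exp_pos _) hpos) _ |>.imp fun ε h => by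
      simpa [mul_comm] using h
  set F : Plane × ℝ → ℝ := fun p =>
    Real.exp (-K * p.2) * u p.1 p.2 - ε * (logBarrier p.1 + L * p.2) with hF
  have hF₁ : 0 < F (x₁, t₁) := sub_pos.2 hε₁
  -- Beyond this radius `ε φ ≥ M`, which outweighs `e^{-Kt} u`, so the maximum can be sought on a
  -- compact set.
  have hout : ∀ x, ∀ t ∈ Icc 0 T, Real.exp (M / ε) < ‖x‖ → F (x, t) ≤ 0 := fun x t ht hx => by
    have h₁ := le_logBarrier_of_exp_le (by positivity) hx
    rw [div_le_iff₀' hε] at h₁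
    have h₂ : Real.exp (-K * t) * u x t ≤ M := by
      calc Real.exp (-K * t) * u x t ≤ Real.exp (-K * t) * M := by
            gcongr; exact (abs_le.1 (hM x t ht)).2
        _ ≤ 1 * M := by
            gcongr; exact Real.exp_le_one_iff.2 (by nlinarith [ht.1])
        _ = M := one_mul M
    have h₃ : 0 ≤ ε * (L * t) := mul_nonneg hε.le (mul_nonneg hL0.le ht.1)
    simp only [hF]
    linarith
  have hFc : ContinuousOn F (Metric.closedBall 0 (Real.exp (M / ε)) ×ˢ Icc 0 T) := by
    have hlog : Continuous fun p : Plane × ℝ => logBarrier p.1 :=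
      continuous_logBarrier.comp continuous_fst
    exact (ContinuousOn.mul (by fun_prop)
      (hu.continuousOn.mono (prod_mono_left (subset_univ _)))).sub
      (Continuous.continuousOn (by fun_prop))
  have hmem₁ : (x₁, t₁) ∈ Metric.closedBall (0 : Plane) (Real.exp (M / ε)) ×ˢ Icc 0 T := by
    refine ⟨?_, ht₁⟩
    by_contra hx
    exact (hout x₁ t₁ ht₁ (by simpa using hx)).not_gt hF₁
  obtain ⟨⟨x₀, t₀⟩, ⟨-, ht₀⟩, hmax'⟩ :=
    ((isCompact_closedBall (0 : Plane) _).prod isCompact_Icc).exists_isMaxOn ⟨_, hmem₁⟩ hFc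
  have hF₀ : 0 < F (x₀, t₀) := hF₁.trans_le (hmax' hmem₁)
  have hmax : ∀ x, ∀ t ∈ Icc 0 T, F (x, t) ≤ F (x₀, t₀) := fun x t ht => by
    rcases lt_or_ge (Real.exp (M / ε)) ‖x‖ with hx | hx
    · exact (hout x t ht hx).trans hF₀.le
    · exact hmax' ⟨by simpa using hx, ht⟩
  simp only at ht₀
  simp only [hF] at hmax hF₀
  have hE : 0 < Real.exp (-K * t₀) := Real.exp_pos _
  have hu₀ : 0 < u x₀ t₀ := by
    have : 0 ≤ ε * (logBarrier x₀ + L * t₀) :=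
      mul_nonneg hε.le (add_nonneg (logBarrier_nonneg _) (mul_nonneg hL0.le ht₀.1))
    exact pos_of_mul_pos_right (by linarith : 0 < Real.exp (-K * t₀) * u x₀ t₀) hE.le
  have ht₀pos : 0 < t₀ := by
    refine ht₀.1.lt_of_ne fun h => ?_
    rw [← h] at hu₀
    exact (hinit x₀).not_gt hu₀
  have ht₀' : t₀ ∈ Ioc 0 T := ⟨ht₀pos, ht₀.2⟩
  have hexp : HasDerivAt (fun s => Real.exp (-K * s)) (Real.exp (-K * t₀) * -K) t₀ := by
    simpa using ((hasDerivAt_id t₀).const_mul (-K)).exp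
  have hlin : HasDerivAt (fun s => ε * (logBarrier x₀ + L * s)) (ε * L) t₀ := by
    simpa using (((hasDerivAt_id t₀).const_mul L).const_add (logBarrier x₀)).const_mul ε
  have htime := ((hexp.hasDerivWithinAt.mul
    (hu.differentiable_time x₀ t₀ ht₀').hasDerivWithinAt).sub
      hlin.hasDerivWithinAt).nonneg_of_max_right ht₀pos ht₀.2
        fun s hs => hmax x₀ s ⟨hs.1, hs.2.trans ht₀.2⟩
  -- Dividing by `e^{-K t₀}` makes `c φ` touch `u(·, t₀)` itself, up to an additive constant.
  set c : ℝ := ε / Real.exp (-K * t₀) with hc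
  have hcE : Real.exp (-K * t₀) * c = ε := mul_div_cancel₀ _ hE.ne'
  have hc0 : 0 < c := div_pos hε hE
  have hspace := sum_partialDeriv_le_of_isLocalMax_sub_logBarrier (hu.contDiff_space t₀ ht₀')
    (x := x₀) hc0.le fun y => by
      have := hmax y t₀ ht₀
      refine le_of_mul_le_mul_left ?_ hE
      rw [mul_sub, mul_sub, ← mul_assoc, ← mul_assoc, hcE]
      linarith
  have hlap : laplaceBeltrami (g t₀) (fun y => u y t₀) x₀ ≤ 4 * C * c := by
    rw [laplaceBeltrami_of_conformal (hw t₀ ht₀)]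
    have hinv : 0 ≤ (Real.exp (2 * w x₀ t₀))⁻¹ := (inv_pos.2 (Real.exp_pos _)).le
    refine (mul_le_mul_of_nonneg_left hspace hinv).trans ?_
    split_ifs with hx
    · have := hC x₀ (by nlinarith [norm_nonneg x₀]) t₀ ht₀
      nlinarith
    · rw [mul_zero]; positivity
  have hreact : h x₀ t₀ * u x₀ t₀ ≤ K * u x₀ t₀ :=
    mul_le_mul_of_nonneg_right (abs_le.1 (hK x₀ t₀ ht₀)).2 hu₀.le
  have hpde := mul_le_mul_of_nonneg_left
    (((hineq x₀ t₀ ht₀').trans (add_le_add hlap hreact))) hE.le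
  have hfin : Real.exp (-K * t₀) * (4 * C * c + K * u x₀ t₀) =
      4 * C * ε + Real.exp (-K * t₀) * K * u x₀ t₀ := by
    rw [← hcE]; ring
  rw [hfin] at hpde
  rw [hL] at htime
  -- The `K` terms cancel, leaving `0 ≤ 4 C ε - (4 C + 1) ε = -ε`.
  nlinarith
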